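/- Let $\mathcal G=(\mathcal V,\mathcal E)$ be a finite directed graph with $n=|\mathcal V|$ nodes, whose edge $e$ goes from $\mathrm{tail}(e)$ to $\mathrm{head}(e)$, and let $v_0\in\mathcal V$ be a gateway node with incoming edges $\mathrm{In}(v_0)=\{e:\mathrm{head}(e)=v_0\}$. Given coefficients $\alpha_{e,v}(t),\beta_{e,e'}(t),b_e(t)\in\mathbb R$, define the matrices $F(t)$ with $F(t)_{e,e'}=\beta_{e,e'}(t)$ if $\mathrm{tail}(e)=\mathrm{head}(e')$ and $0$ otherwise, $A(t)$ with $A(t)_{e,v}=\alpha_{e,v}(t)$ if $\mathrm{tail}(e)=v$ and $0$ otherwise, and $B(t)$ with rows indexed by $i\in\mathrm{In}(v_0)$, $B(t)_{i,e}=b_e(t)$ if $i=e$ and $0$ otherwise. Put $$\Psi(\tau)=B(\tau)\sum_{t'=2}^{\tau}F(\tau)F(\tau-1)\cdots F(t'+1)\,A(t'),$$ and let $\Psi_{tot}(t)$ be the matrix obtained by stacking $\Psi(2),\dots,\Psi(t)$. Assume that $\beta_{e,e'}(t)$ and $b_e(t)$ are deterministic, that $\alpha_{e,\mathrm{tail}(e)}(t)=0$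 for all $e$ and all $t>2$, and that the $\alpha_{e,\mathrm{tail}(e)}(2)$, $e\in\mathcal E$, are independent zero-mean Gaussian random variables, with standard deviations $\sigma_e\ge 0$. Let $\Omega(t)$ be the matrix obtained by stacking $B(\tau)F(\tau)\cdots F(3)$ for $\tau=2,\dots,t$, and for $x\in\mathbb R^{\mathcal V}$ let $\lambda_e(x)$, $e\in\mathcal E$, be the eigenvalues (with multiplicity) of the symmetric matrix $\Gamma(x)$ with entries $$\gamma_{e,e'}(x)=\sum_{i}\Omega(t)_{i,e}\,\Omega(t)_{i,e'}\,(\sigma_e x_{\mathrm{tail}(e)})(\sigma_{e'}x_{\mathrm{tail}(e')}).$$ Let $0\le k\le n$ and $0<\delta_k<1$, and for $\|x\|_2=1$ put $$J(x)=\int_{-\infty}^{+\infty}\frac{e^{-j\omega}\sin\big(\tfrac{\delta_k}{\sqrt2}\,\omega\big)}{\omega\prod_{e\in\mathcal E}\sqrt{1-2j\omega\lambda_e(x)}}\,d\omega ,$$ where $j$ is the imaginary unit, the square roots are principal, and the integral is the limit of the integrals over $[-R,R]$ as $R\to\infty$. Then: 1. For every $x$ with $\|x\|_2=1$ the limit $J(x)$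 exists and is real, and $\mathbf P\big(\big|\|\Psi_{tot}(t)x\|_2^2-1\big|\ge \delta_k/\sqrt2\big)=1-\frac1\pi J(x)$. 2. $J$ attains its minimum over the unit sphere $\|x\|_2=1$. 3. For every (deterministic) orthogonal $n\times n$ matrix $\phi$, the matrix $\Theta=\Psi_{tot}(t)\,\phi$ satisfies the restricted isometry property of order $k$ with constant $\delta_k$, that is, $(1-\delta_k)\|s\|_2^2\le\|\Theta s\|_2^2\le(1+\delta_k)\|s\|_2^2$ for all $s\in\mathbb R^n$ with at most $k$ non-zero entries, with a probability strictly greater than $$\mathbf p_{RIP}=1-\binom nk\Big(\frac{42}{\delta_k}\Big)^k\Big(1-\frac1\pi\min_{\|x\|_2=1}J(x)\Big).$$ -/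

import Mathlib

open MeasureTheory ProbabilityTheory Filter Topology
open scoped Matrix NNReal

noncomputable section

/-- A sensor network: a finite directed (multi)graph with node set `V` and edge set `E`; the edge
`e` goes from the node `tail e` to the node `head e`, and `gateway` is the decoder node. -/
structure Network (V E : Type*) where
  tail : E → V
  head : E → V
  gateway : V

namespace Network

variable {V E : Type*} [DecidableEq V] [Fintype E] [DecidableEq E]

/-- The incoming edges of the gateway; they index the marginal measurements at one time. -/
abbrev InGateway (N : Network V E) : Type _ := {e : E // N.head e = N.gateway}

/-- The rows of the total measurement matrix at time `t`: a time `2 ≤ τ ≤ t` together with an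
incoming edge of the gateway. -/
abbrev Rows (N : Network V E) (t : ℕ) : Type _ := {τ : ℕ // τ ∈ Finset.Icc 2 t} × N.InGateway

/-- `F(t)`, with entry `β_{e,e'}(t)` if `tail e = head e'`, and `0` otherwise. -/
def matF (N : Network V E) (β : ℕ → E → E → ℝ) (t : ℕ) : Matrix E E ℝ :=
  Matrix.of fun e e' => if N.tail e = N.head e' then β t e e' else 0

/-- `A(t)`, with entry `α_{e,v}(t)` if `tail e = v`, and `0` otherwise. -/
def matA (N : Network V E) (α : ℕ → E → V → ℝ) (t : ℕ) : Matrix E V ℝ :=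
  Matrix.of fun e v => if N.tail e = v then α t e v else 0

/-- `B(t)`, whose row of the incoming edge `i` of the gateway has the entry `b_i(t)` in the column
`i`, and `0` elsewhere. -/
def matB (N : Network V E) (b : ℕ → E → ℝ) (t : ℕ) : Matrix N.InGateway E ℝ :=
  Matrix.of fun i e => if (i : E) = e then b t e else 0

/-- `descProd N β s d = F(s+d) ⋯ F(s+2) F(s+1)`, the identity for `d = 0`. -/
def descProd (N : Network V E) (β : ℕ → E → E → ℝ) (s : ℕ) : ℕ → Matrix E E ℝ
  | 0 => 1
  | d + 1 => N.matF β (s + d + 1) * descProd N β s d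

/-- `Ψ(t) = B(t) ∑_{t'=2}^{t} F(t) ⋯ F(t'+1) A(t')`. -/
def Psi (N : Network V E) (b : ℕ → E → ℝ) (β : ℕ → E → E → ℝ) (α : ℕ → E → V → ℝ) (t : ℕ) :
    Matrix N.InGateway V ℝ :=
  N.matB b t * ∑ t' ∈ Finset.Icc 2 t, N.descProd β t' (t - t') * N.matA α t'

/-- The total measurement matrix: `Ψ(2), …, Ψ(t)` stacked. -/
def PsiTot (N : Network V E) (b : ℕ → E → ℝ) (β : ℕ → E → E → ℝ) (α : ℕ → E → V → ℝ) (t : ℕ) :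
    Matrix (N.Rows t) V ℝ :=
  Matrix.of fun r v => N.Psi b β α r.1 r.2 v

/-- `Ω(t)`: the blocks `B(τ) F(τ) ⋯ F(3)`, `τ = 2, …, t`, stacked. -/
def Omega (N : Network V E) (b : ℕ → E → ℝ) (β : ℕ → E → E → ℝ) (t : ℕ) :
    Matrix (N.Rows t) E ℝ :=
  Matrix.of fun r e => (N.matB b r.1 * N.descProd β 2 (r.1 - 2)) r.2 e

/-- `Γ(x)`, for source coefficients `α_{e,tail(e)}(2)` of standard deviations `σ_e`: the matrix with
entries `∑ᵢ Ω_{i,e} Ω_{i,e'} (σ_e x_{tail(e)}) (σ_{e'} x_{tail(e')})`. -/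
def Gam (N : Network V E) (b : ℕ → E → ℝ) (β : ℕ → E → E → ℝ) (σ : E → ℝ≥0) (t : ℕ)
    (x : EuclideanSpace ℝ V) : Matrix E E ℝ :=
  Matrix.of fun e e' => ∑ i : N.Rows t,
    N.Omega b β t i e * N.Omega b β t i e' * ((σ e * x (N.tail e)) * (σ e' * x (N.tail e')))

theorem gam_isHermitian (N : Network V E) (b : ℕ → E → ℝ) (β : ℕ → E → E → ℝ) (σ : E → ℝ≥0)
    (t : ℕ) (x : EuclideanSpace ℝ V) : (N.Gam b β σ t x).IsHermitian := by
  ext e e'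
  simp only [Gam, Matrix.conjTranspose_apply, Matrix.of_apply, star_trivial]
  exact Finset.sum_congr rfl fun i _ => by ring

/-- The eigenvalues `λ_e(x)` of `Γ(x)`, with multiplicity. -/
def eigen (N : Network V E) (b : ℕ → E → ℝ) (β : ℕ → E → E → ℝ) (σ : E → ℝ≥0) (t : ℕ)
    (x : EuclideanSpace ℝ V) (e : E) : ℝ :=
  (N.gam_isHermitian b β σ t x).eigenvalues e

/-- The integrand `e^{-jω} sin(εω) / (ω ∏_e √(1 - j2ωλ_e(x)))` (principal square roots). -/
def integrand (N : Network V E) (b : ℕ → E → ℝ) (β : ℕ → E → E → ℝ) (σ : E → ℝ≥0) (t : ℕ)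
    (ε : ℝ) (x : EuclideanSpace ℝ V) (ω : ℝ) : ℂ :=
  Complex.exp (-(Complex.I * ω)) * (Real.sin (ε * ω) : ℂ) /
    (ω * ∏ e : E, (1 - Complex.I * 2 * ω * (N.eigen b β σ t x e : ℂ)) ^ (1 / 2 : ℂ))

/-- The integral of the integrand over `[-R, R]`. -/
def truncIntegral (N : Network V E) (b : ℕ → E → ℝ) (β : ℕ → E → E → ℝ) (σ : E → ℝ≥0) (t : ℕ)
    (ε : ℝ) (x : EuclideanSpace ℝ V) (R : ℝ) : ℂ :=
  ∫ ω in (-R)..R, N.integrand b β σ t ε x ω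

/-- The (improper) integral of the integrand over the real line, as a real number. -/
def tailIntegral (N : Network V E) (b : ℕ → E → ℝ) (β : ℕ → E → E → ℝ) (σ : E → ℝ≥0) (t : ℕ)
    (ε : ℝ) (x : EuclideanSpace ℝ V) : ℝ :=
  (limUnder atTop (N.truncIntegral b β σ t ε x)).re

/-- The minimum of the integral over the unit vectors. -/
def minTailIntegral [Fintype V] (N : Network V E) (b : ℕ → E → ℝ) (β : ℕ → E → E → ℝ) (σ : E → ℝ≥0) (t : ℕ)
    (ε : ℝ) : ℝ :=
  sInf (N.tailIntegral b β σ t ε '' {x | ‖x‖ = 1})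

/-- The lower bound `p_RIP` for the probability of the restricted isometry property. -/
def pRIP [Fintype V] (N : Network V E) (b : ℕ → E → ℝ) (β : ℕ → E → E → ℝ) (σ : E → ℝ≥0) (t k : ℕ)
    (δ : ℝ) : ℝ :=
  1 - ((Fintype.card V).choose k : ℝ) * (42 / δ) ^ k *
    (1 - 1 / Real.pi * N.minTailIntegral b β σ t (δ / √2))

end Network

/-- The squared Euclidean norm of `Θ s`. -/
def measNormSq {ι V : Type*} [Fintype ι] [Fintype V] (Θ : Matrix ι V ℝ)
    (s : EuclideanSpace ℝ V) : ℝ :=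
  ‖WithLp.toLp 2 (Θ *ᵥ s.ofLp)‖ ^ 2

/-- The restricted isometry property of order `k` with constant `δ`. -/
def IsRIP {ι V : Type*} [Fintype ι] [Fintype V] (k : ℕ) (δ : ℝ) (Θ : Matrix ι V ℝ) : Prop :=
  ∀ s : EuclideanSpace ℝ V, {v | s v ≠ 0}.ncard ≤ k →
    (1 - δ) * ‖s‖ ^ 2 ≤ measNormSq Θ s ∧ measNormSq Θ s ≤ (1 + δ) * ‖s‖ ^ 2

end

/-! Only the time-2 source terms survive, so `PsiTot` factors through `Omega`, and the squared norm
of the measurements of `x` has the law of the quadratic form of `Gam` in a standard Gaussian vector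
(`hasLaw_measNormSq_PsiTot`). By rotation invariance this is the law of `∑ λ_e g_e²`, whose
characteristic function is `∏ (1 - 2jωλ_e)^(-1/2)`. Hence `J(x)` is the Lévy inversion integral,
equal to `π` times the mass of `(1 - ε, 1 + ε)` with `ε = δ/√2`
(`tendsto_integral_charFun_mul_sinc`). The endpoints are positive, and the law can only have an atom
at `0` (`ae_sum_mul_sq_ne`). The same absence of atoms makes the deviation probability continuous in
`x`, so `J` attains its minimum on the compact sphere.

For the isometry property, each `k`-dimensional coordinate subspace has a `1/7`-net of at most
`15^k` unit vectors (`exists_net_unit_sphere`). Tolerance `δ/√2` on the net gives tolerance `δ` on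
the subspace (`abs_norm_sq_sub_le_of_net`), and a union bound over the nets concludes. An orthogonal
`φ` only moves the net points along the sphere. The inequality is strict because `15 < 42/δ` and the
deviation probability is positive; for `k = 0` the net is empty. -/

noncomputable section

/-! ### The Dirichlet integral and a uniform bound for its truncations. -/

section SineIntegral

/-- The sine integral `∫₀ᵘ sin x / x dx`. -/
def sineIntegral (u : ℝ) : ℝ := ∫ x in (0 : ℝ)..u, Real.sinc x

theorem sineIntegral_neg (u : ℝ) : sineIntegral (-u) = -sineIntegral u := by
  have h := intervalIntegral.integral_comp_neg (a := 0) (b := u) Real.sinc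
  simp only [Real.sinc_neg, neg_zero] at h
  rw [sineIntegral, sineIntegral, h, intervalIntegral.integral_symm]

theorem continuous_sineIntegral : Continuous sineIntegral :=
  intervalIntegral.continuous_primitive
    (fun _ _ => Real.continuous_sinc.intervalIntegrable _ _) 0

theorem mul_integral_sinc_mul (a R : ℝ) :
    ∫ ω in (0 : ℝ)..R, a * Real.sinc (a * ω) = sineIntegral (a * R) := by
  rw [intervalIntegral.integral_const_mul, intervalIntegral.mul_integral_comp_mul_left, mul_zero,
    sineIntegral]

theorem integral_sin_mul_exp_neg_mul (R y : ℝ) :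
    ∫ x in (0 : ℝ)..R, Real.sin x * Real.exp (-(x * y)) =
      (1 + y ^ 2)⁻¹ - Real.exp (-(R * y)) * (Real.cos R + y * Real.sin R) / (1 + y ^ 2) := by
  have hy : (1 + y ^ 2) ≠ 0 := by positivity
  rw [intervalIntegral.integral_eq_sub_of_hasDerivAt
    (f := fun x => -(Real.exp (-(x * y)) * (Real.cos x + y * Real.sin x) / (1 + y ^ 2)))]
  · simp
    field_simp
    ring
  · intro x _
    have h1 : HasDerivAt (fun x => Real.exp (-(x * y))) (Real.exp (-(x * y)) * (-y)) x :=
      (hasDerivAt_mul_const y).neg.exp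
    have h2 : HasDerivAt (fun x => Real.cos x + y * Real.sin x)
        (-Real.sin x + y * Real.cos x) x :=
      (Real.hasDerivAt_cos x).add ((Real.hasDerivAt_sin x).const_mul y)
    refine ((h1.mul h2).div_const (1 + y ^ 2)).neg.congr_deriv ?_
    field_simp
    ring
  · exact Continuous.intervalIntegrable (by fun_prop) _ _

theorem integral_exp_neg_mul_Ioi_zero {x : ℝ} (hx : 0 < x) :
    ∫ y in Set.Ioi (0 : ℝ), Real.exp (-(x * y)) = x⁻¹ := by
  have h := integral_exp_mul_Ioi (neg_lt_zero.2 hx) 0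
  simpa [neg_mul, div_neg, neg_div] using h

theorem integrableOn_exp_neg_mul_Ioi {x : ℝ} (hx : 0 < x) :
    IntegrableOn (fun y => Real.exp (-(x * y))) (Set.Ioi 0) := by
  simpa [neg_mul] using exp_neg_integrableOn_Ioi 0 hx

/-- Write `1/x = ∫ e^(-xy) dy` over `y > 0` and apply Fubini; absolute integrability holds because
the inner integral of the norm is `|sin x|/x ≤ 1` on the bounded interval. -/
theorem sineIntegral_eq_integral_Ioi {R : ℝ} (hR : 0 < R) :
    sineIntegral R = ∫ y in Set.Ioi (0 : ℝ), ((1 + y ^ 2)⁻¹ -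
      Real.exp (-(R * y)) * (Real.cos R + y * Real.sin R) / (1 + y ^ 2)) := by
  have hint : Integrable (Function.uncurry fun x y : ℝ => Real.sin x * Real.exp (-(x * y)))
      ((volume.restrict (Set.Ioc 0 R)).prod (volume.restrict (Set.Ioi 0))) := by
    rw [integrable_prod_iff (Continuous.aestronglyMeasurable (by fun_prop))]
    constructor
    · filter_upwards [ae_restrict_mem measurableSet_Ioc] with x hx
      exact (integrableOn_exp_neg_mul_Ioi hx.1).const_mul (Real.sin x)
    · have : IntegrableOn (fun _ : ℝ => (1 : ℝ)) (Set.Ioc 0 R) := by simp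
      refine this.mono' ?_ ?_
      · exact (Continuous.stronglyMeasurable (by fun_prop)).norm.integral_prod_right
          |>.aestronglyMeasurable
      · filter_upwards [ae_restrict_mem measurableSet_Ioc] with x hx
        simp only [Function.uncurry_apply_pair, norm_mul, Real.norm_eq_abs, Real.abs_exp]
        rw [integral_const_mul, integral_exp_neg_mul_Ioi_zero hx.1, abs_mul, abs_abs, abs_inv,
          ← div_eq_mul_inv]
        exact div_le_one_of_le₀ Real.abs_sin_le_abs (abs_nonneg _)
  calc sineIntegral R
      = ∫ x in Set.Ioc 0 R, ∫ y in Set.Ioi (0 : ℝ), Real.sin x * Real.exp (-(x * y)) := by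
        rw [sineIntegral, intervalIntegral.integral_of_le hR.le]
        refine setIntegral_congr_fun measurableSet_Ioc fun x hx => ?_
        rw [integral_const_mul, integral_exp_neg_mul_Ioi_zero hx.1, Real.sinc_of_ne_zero hx.1.ne',
          div_eq_mul_inv]
    _ = ∫ y in Set.Ioi (0 : ℝ), ∫ x in Set.Ioc 0 R, Real.sin x * Real.exp (-(x * y)) :=
        integral_integral_swap hint
    _ = _ := by
        refine setIntegral_congr_fun measurableSet_Ioi fun y _ => ?_
        rw [← intervalIntegral.integral_of_le hR.le, integral_sin_mul_exp_neg_mul]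

/-- The term `(1 + y²)⁻¹` integrates to `π/2`; the remainder is at most `2 e^(-Ry)` since `1 + y ≤
2(1 + y²)`. -/
theorem abs_sineIntegral_sub_le {R : ℝ} (hR : 0 < R) :
    |sineIntegral R - Real.pi / 2| ≤ 2 * R⁻¹ := by
  have hb : ∀ y ∈ Set.Ioi (0 : ℝ),
      ‖Real.exp (-(R * y)) * (Real.cos R + y * Real.sin R) / (1 + y ^ 2)‖ ≤
        2 * Real.exp (-(R * y)) := by
    intro y hy
    have hy : (0 : ℝ) < y := hy
    rw [norm_div, norm_mul, Real.norm_eq_abs, Real.norm_eq_abs, Real.norm_eq_abs, Real.abs_exp,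
      abs_of_pos (by positivity : (0 : ℝ) < 1 + y ^ 2), div_le_iff₀ (by positivity)]
    have : |Real.cos R + y * Real.sin R| ≤ 2 * (1 + y ^ 2) := by
      have h1 : |y * Real.sin R| ≤ y := by
        rw [abs_mul, abs_of_pos hy]
        exact mul_le_of_le_one_right hy.le (Real.abs_sin_le_one R)
      refine (abs_add_le _ _).trans ((add_le_add (Real.abs_cos_le_one R) h1).trans ?_)
      nlinarith [sq_nonneg (y - 1)]
    calc _ ≤ Real.exp (-(R * y)) * (2 * (1 + y ^ 2)) := by gcongr
      _ = _ := by ring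
  have hi : IntegrableOn (fun y => 2 * Real.exp (-(R * y))) (Set.Ioi 0) :=
    (integrableOn_exp_neg_mul_Ioi hR).const_mul 2
  have hi' : IntegrableOn
      (fun y => Real.exp (-(R * y)) * (Real.cos R + y * Real.sin R) / (1 + y ^ 2))
      (Set.Ioi 0) := by
    refine hi.mono' (Measurable.aestronglyMeasurable (by fun_prop)) ?_
    filter_upwards [ae_restrict_mem measurableSet_Ioi] with y hy using hb y hy
  rw [sineIntegral_eq_integral_Ioi hR, integral_sub integrable_inv_one_add_sq.integrableOn hi',
    integral_Ioi_inv_one_add_sq, Real.arctan_zero, sub_zero, sub_sub_cancel_left, abs_neg]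
  calc _ ≤ ∫ y in Set.Ioi (0 : ℝ), 2 * Real.exp (-(R * y)) :=
        norm_integral_le_of_norm_le hi
          (by filter_upwards [ae_restrict_mem measurableSet_Ioi] with y hy using hb y hy)
    _ = _ := by rw [integral_const_mul, integral_exp_neg_mul_Ioi_zero hR]

theorem tendsto_sineIntegral_atTop : Tendsto sineIntegral atTop (𝓝 (Real.pi / 2)) := by
  rw [tendsto_iff_norm_sub_tendsto_zero]
  have h : Tendsto (fun R : ℝ => 2 * R⁻¹) atTop (𝓝 0) := by
    simpa using tendsto_inv_atTop_zero.const_mul (2 : ℝ)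
  refine squeeze_zero' (Eventually.of_forall fun _ => norm_nonneg _) ?_ h
  filter_upwards [eventually_gt_atTop 0] with R hR using abs_sineIntegral_sub_le hR

/-- Uniformity in `u` is what dominated convergence needs in the inversion formula. -/
theorem abs_sineIntegral_le (u : ℝ) : |sineIntegral u| ≤ 4 := by
  have key : ∀ v, 0 ≤ v → |sineIntegral v| ≤ 4 := by
    intro v hv
    rcases le_total v 1 with h | h
    · have := intervalIntegral.norm_integral_le_of_norm_le_const (a := 0) (b := v) (C := 1)
        (f := Real.sinc) fun x _ => Real.abs_sinc_le_one x
      rw [sub_zero, abs_of_nonneg hv, one_mul] at this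
      exact this.trans (by linarith)
    · have h1 := abs_sineIntegral_sub_le (by linarith : 0 < v)
      have h2 : v⁻¹ ≤ 1 := inv_le_one_of_one_le₀ h
      have := Real.pi_le_four
      have := Real.pi_pos
      rw [abs_le] at h1 ⊢
      constructor <;> linarith
  rcases le_total 0 u with h | h
  · exact key u h
  · have := key (-u) (by linarith)
    rwa [sineIntegral_neg, abs_neg] at this

theorem tendsto_sineIntegral_mul {a : ℝ} (ha : a ≠ 0) :
    Tendsto (fun R => sineIntegral (a * R)) atTop (𝓝 (SignType.sign a * (Real.pi / 2))) := by
  rcases lt_or_gt_of_ne ha with h | h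
  · have h1 := (tendsto_sineIntegral_atTop.comp
      (tendsto_id.const_mul_atTop (neg_pos.2 h))).neg
    refine (h1.congr fun R => ?_).trans (by simp [sign_neg h])
    simp [sineIntegral_neg]
  · simpa [sign_pos h, Function.comp_def] using
      tendsto_sineIntegral_atTop.comp (tendsto_id.const_mul_atTop h)

end SineIntegral

/-! ### Lévy inversion on an interval. -/

section Inversion

/-- Folding `[-R, R]` onto `[0, R]` turns the exponential into `2 cos(ωy)`, and the product with
`sin(εω)` splits into two sines. The form `ε * sinc(εω)` removes the singularity of `sin(εω)/ω` at
`0`. -/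
theorem integral_exp_mul_sinc (ε y R : ℝ) :
    ∫ ω in (-R)..R, Complex.exp (ω * y * Complex.I) * ((ε * Real.sinc (ε * ω) : ℝ) : ℂ) =
      ((sineIntegral ((ε + y) * R) + sineIntegral ((ε - y) * R) : ℝ) : ℂ) := by
  set f : ℝ → ℂ := fun ω => Complex.exp (ω * y * Complex.I) * ((ε * Real.sinc (ε * ω) : ℝ) : ℂ)
  have hf : Continuous f := by fun_prop
  have h0 : ∫ ω in (-R)..0, f ω = ∫ ω in (0 : ℝ)..R, f (-ω) := by
    simp
  rw [← intervalIntegral.integral_add_adjacent_intervals (b := 0) (hf.intervalIntegrable _ _)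
    (hf.intervalIntegrable _ _), h0, ← intervalIntegral.integral_add
    (Continuous.intervalIntegrable (by fun_prop) _ _) (hf.intervalIntegrable _ _),
    ← mul_integral_sinc_mul, ← mul_integral_sinc_mul, ← intervalIntegral.integral_add
    (Continuous.intervalIntegrable (by fun_prop) _ _)
    (Continuous.intervalIntegrable (by fun_prop) _ _), ← intervalIntegral.integral_ofReal]
  refine intervalIntegral.integral_congr fun ω _ => ?_
  simp only [f, mul_neg, Real.sinc_neg]
  rw [← add_mul]
  have h1 : Complex.exp (((-ω : ℝ) : ℂ) * y * Complex.I) + Complex.exp (ω * y * Complex.I) =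
      ((2 * Real.cos (ω * y) : ℝ) : ℂ) := by
    push_cast
    rw [Complex.two_cos, add_comm]
    congr 2; ring
  rw [h1, ← Complex.ofReal_mul]
  congr 1
  have h2 : ∀ a : ℝ, ω ≠ 0 → a * Real.sinc (a * ω) = Real.sin (a * ω) / ω := by
    intro a hω
    by_cases ha : a = 0
    · simp [ha]
    · rw [Real.sinc_of_ne_zero (mul_ne_zero ha hω)]
      field_simp
  by_cases hω : ω = 0
  · subst hω; simp; ring
  · rw [h2 _ hω, h2 _ hω, h2 _ hω, add_mul, sub_mul, Real.sin_add, Real.sin_sub, mul_comm ω y]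
    ring

/-- Each term tends to `±π/2`: the signs agree inside the interval and cancel outside. At `|y| = ε`
the limit would be `π/2`, hence the exclusion. -/
theorem tendsto_sineIntegral_add_sub {ε y : ℝ} (hε : 0 < ε) (hy : |y| ≠ ε) :
    Tendsto (fun R => sineIntegral ((ε + y) * R) + sineIntegral ((ε - y) * R)) atTop
      (𝓝 (Set.indicator {y : ℝ | |y| < ε} (fun _ => Real.pi) y)) := by
  have h1 : ε + y ≠ 0 := fun h => hy (by
    rw [show y = -ε by linarith, abs_neg, abs_of_pos hε])
  have h2 : ε - y ≠ 0 := fun h => hy (by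
    rw [show y = ε by linarith, abs_of_pos hε])
  convert (tendsto_sineIntegral_mul h1).add (tendsto_sineIntegral_mul h2) using 2
  by_cases h : |y| < ε
  · have := abs_lt.1 h
    rw [Set.indicator_of_mem (by exact h), sign_pos (by linarith), sign_pos (by linarith)]
    simp
  · rw [Set.indicator_of_notMem (by exact h)]
    rcases lt_abs.1 (lt_of_le_of_ne (not_lt.1 h) hy.symm) with h | h
    · rw [sign_pos (by linarith), sign_neg (by linarith)]; simp
    · rw [sign_neg (by linarith), sign_pos (by linarith)]; simp

/-- The inversion formula of Lévy for an interval `(c - ε, c + ε)` without atoms at its ends. -/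
theorem tendsto_integral_charFun_mul_sinc (μ : Measure ℝ) [IsProbabilityMeasure μ] (c : ℝ) {ε : ℝ}
    (hε : 0 < ε) (hatom : ∀ᵐ z ∂μ, |z - c| ≠ ε) :
    Tendsto (fun R => ∫ ω in (-R)..R, Complex.exp (-(Complex.I * (c * ω))) *
        ((ε * Real.sinc (ε * ω) : ℝ) : ℂ) * charFun μ ω) atTop
      (𝓝 ((Real.pi * μ.real {z | |z - c| < ε} : ℝ) : ℂ)) := by
  -- At finite `R`, Fubini applies because the kernel is bounded by `ε` on a finite measure space.
  have hswap : ∀ R, 0 ≤ R → ∫ ω in (-R)..R, Complex.exp (-(Complex.I * (c * ω))) *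
        ((ε * Real.sinc (ε * ω) : ℝ) : ℂ) * charFun μ ω =
      ((∫ z, (sineIntegral ((ε + (z - c)) * R) + sineIntegral ((ε - (z - c)) * R)) ∂μ : ℝ) : ℂ) := by
    intro R hR
    have hint : Integrable (Function.uncurry fun (ω z : ℝ) =>
        Complex.exp (ω * (z - c : ℝ) * Complex.I) * ((ε * Real.sinc (ε * ω) : ℝ) : ℂ))
        ((volume.restrict (Set.uIoc (-R) R)).prod μ) := by
      have : Integrable (fun _ : ℝ × ℝ => ε) ((volume.restrict (Set.uIoc (-R) R)).prod μ) := by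
        rw [Set.uIoc_of_le (by linarith)]
        exact integrable_const _
      refine this.mono' (Continuous.aestronglyMeasurable (by fun_prop)) (.of_forall ?_)
      rintro ⟨ω, z⟩
      simp only [Function.uncurry_apply_pair, norm_mul, Complex.norm_real]
      rw [← Complex.ofReal_mul, Complex.norm_exp_ofReal_mul_I, one_mul, Real.norm_eq_abs,
        Real.norm_eq_abs, abs_of_pos hε]
      exact mul_le_of_le_one_right hε.le (Real.abs_sinc_le_one _)
    rw [← integral_complex_ofReal]
    simp_rw [← integral_exp_mul_sinc]
    rw [← intervalIntegral_integral_swap hint]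
    refine intervalIntegral.integral_congr fun ω _ => ?_
    rw [charFun_apply_real, ← integral_const_mul]
    congr with z
    rw [mul_right_comm, ← Complex.exp_add]
    congr 2
    push_cast; ring
  have hlim : Tendsto (fun R => ∫ z, (sineIntegral ((ε + (z - c)) * R) +
      sineIntegral ((ε - (z - c)) * R)) ∂μ) atTop
      (𝓝 (∫ z, Set.indicator {y : ℝ | |y| < ε} (fun _ => Real.pi) (z - c) ∂μ)) := by
    -- Two sine integrals, each bounded by `4`.
    refine tendsto_integral_filter_of_dominated_convergence (fun _ => 8) ?_ ?_
      (integrable_const _) ?_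
    · have := continuous_sineIntegral
      exact .of_forall fun R => Continuous.aestronglyMeasurable (by fun_prop)
    · refine .of_forall fun R => .of_forall fun z => (norm_add_le _ _).trans ?_
      have h1 := abs_sineIntegral_le ((ε + (z - c)) * R)
      have h2 := abs_sineIntegral_le ((ε - (z - c)) * R)
      simp only [Real.norm_eq_abs]
      linarith
    · filter_upwards [hatom] with z hz using tendsto_sineIntegral_add_sub hε hz
  have hval : ∫ z, Set.indicator {y : ℝ | |y| < ε} (fun _ => Real.pi) (z - c) ∂μ =
      Real.pi * μ.real {z | |z - c| < ε} := by
    have hm : MeasurableSet {z : ℝ | |z - c| < ε} :=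
      measurableSet_lt (by fun_prop) measurable_const
    have : (fun z => Set.indicator {y : ℝ | |y| < ε} (fun _ => Real.pi) (z - c)) =
        Set.indicator {z | |z - c| < ε} (fun _ => Real.pi) := by
      ext z; simp [Set.indicator]
    rw [this, integral_indicator_const _ hm, smul_eq_mul, mul_comm]
  rw [hval] at hlim
  refine ((Complex.continuous_ofReal.tendsto _).comp hlim).congr' ?_
  filter_upwards [eventually_ge_atTop 0] with R hR using (hswap R hR).symm

end Inversion

/-! ### Quadratic forms in standard Gaussian variables. -/

section GaussianQuadraticForm

variable {E : Type*} [Fintype E]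

/-- The law of a vector of independent standard Gaussian variables. -/
abbrev gaussianPi (E : Type*) [Fintype E] : Measure (E → ℝ) :=
  Measure.pi fun _ => gaussianReal 0 1

theorem integral_exp_sq_gaussianReal (s : ℝ) :
    ∫ g, Complex.exp (Complex.I * s * (g : ℂ) ^ 2) ∂(gaussianReal 0 1) =
      ((1 - Complex.I * 2 * s) ^ (1 / 2 : ℂ))⁻¹ := by
  set z : ℂ := 1 - Complex.I * 2 * s with hz
  have hre : z.re = 1 := by simp [hz]
  have hz0 : z ≠ 0 := fun h => by simp [h] at hre
  have harg : z.arg ≠ Real.pi := by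
    rw [Ne, Complex.arg_eq_pi_iff]
    rintro ⟨h, -⟩
    linarith
  have hb : 0 < (z / 2).re := by simp [hre]
  rw [integral_gaussianReal_eq_integral_smul one_ne_zero]
  have h1 : ∀ g : ℝ, gaussianPDFReal 0 1 g • Complex.exp (Complex.I * s * (g : ℂ) ^ 2) =
      ((√(2 * Real.pi))⁻¹ : ℝ) * Complex.exp (-(z / 2) * (g : ℂ) ^ 2) := by
    intro g
    rw [gaussianPDFReal, Complex.real_smul, Complex.ofReal_mul, Complex.ofReal_exp, mul_assoc,
      ← Complex.exp_add]
    congr 2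
    · simp
    · rw [hz]
      push_cast
      ring
  simp_rw [h1]
  rw [integral_const_mul, integral_gaussian_complex hb]
  have h2 : (Real.pi : ℂ) / (z / 2) = ((2 * Real.pi : ℝ) : ℂ) * z⁻¹ := by
    push_cast
    field_simp
  -- Principal powers are not multiplicative in general; here one factor is a positive real, and `z`
  -- has real part `1`, so inversion avoids the branch cut.
  have h3 : ((((2 * Real.pi : ℝ) : ℂ)) * z⁻¹) ^ (1 / 2 : ℂ) =
      (√(2 * Real.pi) : ℝ) * (z ^ (1 / 2 : ℂ))⁻¹ := by
    rw [← Complex.inv_cpow _ _ harg, Real.sqrt_eq_rpow, Complex.ofReal_cpow (by positivity),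
      Complex.cpow_def_of_ne_zero (mul_ne_zero (by simp [Real.pi_ne_zero]) (inv_ne_zero hz0)),
      Complex.cpow_def_of_ne_zero (by simp [Real.pi_ne_zero]),
      Complex.cpow_def_of_ne_zero (inv_ne_zero hz0),
      Complex.log_ofReal_mul (by positivity) (inv_ne_zero hz0), Complex.ofReal_log (by positivity),
      ← Complex.exp_add]
    congr 1
    push_cast
    ring
  rw [h2, h3, ← mul_assoc, ← Complex.ofReal_mul, inv_mul_cancel₀ (by positivity),
    Complex.ofReal_one, one_mul]

theorem charFun_map_sum_mul_sq (c : E → ℝ) (ω : ℝ) :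
    charFun ((gaussianPi E).map fun g => ∑ e, c e * g e ^ 2) ω =
      (∏ e, (1 - Complex.I * 2 * ω * c e) ^ (1 / 2 : ℂ))⁻¹ := by
  rw [charFun_apply_real, integral_map (Measurable.aemeasurable (by fun_prop)) (by fun_prop), ← Finset.prod_inv_distrib]
  have h : ∀ g : E → ℝ, Complex.exp (ω * ((∑ e, c e * g e ^ 2 : ℝ) : ℂ) * Complex.I) =
      ∏ e, Complex.exp (Complex.I * (ω * c e : ℝ) * (g e : ℂ) ^ 2) := by
    intro g
    rw [← Complex.exp_sum]
    congr 1
    push_cast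
    rw [Finset.mul_sum, Finset.sum_mul]
    exact Finset.sum_congr rfl fun e _ => by ring
  simp_rw [h]
  rw [integral_fintype_prod_eq_prod
    (fun e (x : ℝ) => Complex.exp (Complex.I * (ω * c e : ℝ) * (x : ℂ) ^ 2))]
  refine Finset.prod_congr rfl fun e _ => ?_
  rw [integral_exp_sq_gaussianReal]
  push_cast
  congr 3
  ring

/-- The standard Gaussian has independent standard coordinates in every orthonormal basis, in
particular in an eigenbasis of `A`. -/
theorem Matrix.IsHermitian.map_quadraticForm_gaussianPi [DecidableEq E] {A : Matrix E E ℝ}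
    (hA : A.IsHermitian) :
    (gaussianPi E).map (fun g => g ⬝ᵥ A *ᵥ g) =
      (gaussianPi E).map fun g => ∑ e, hA.eigenvalues e * g e ^ 2 := by
  set f : EuclideanSpace ℝ E → ℝ := fun a => a.ofLp ⬝ᵥ A *ᵥ a.ofLp with hf
  have hfc : Continuous f := by
    simp only [hf, dotProduct, Matrix.mulVec]
    fun_prop
  have h1 : (gaussianPi E).map (fun g => g ⬝ᵥ A *ᵥ g) =
      (stdGaussian (EuclideanSpace ℝ E)).map f := by
    rw [← map_pi_eq_stdGaussian, Measure.map_map hfc.measurable (by fun_prop)]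
    rfl
  rw [h1, stdGaussian_eq_map_pi_orthonormalBasis hA.eigenvectorBasis,
    Measure.map_map hfc.measurable (by fun_prop)]
  congr 1
  ext g
  have h2 : A *ᵥ (∑ e, g e • hA.eigenvectorBasis e).ofLp =
      (∑ e, (hA.eigenvalues e * g e) • hA.eigenvectorBasis e).ofLp := by
    rw [WithLp.ofLp_sum, WithLp.ofLp_sum, Matrix.mulVec_sum]
    refine Finset.sum_congr rfl fun e _ => ?_
    rw [WithLp.ofLp_smul, Matrix.mulVec_smul, hA.mulVec_eigenvectorBasis, smul_smul,
      WithLp.ofLp_smul, mul_comm]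
  have h3 := hA.eigenvectorBasis.orthonormal.inner_sum (fun e => hA.eigenvalues e * g e) g
    Finset.univ
  simp only [Function.comp_apply, hf]
  rw [h2]
  rw [EuclideanSpace.inner_eq_star_dotProduct] at h3
  simp only [star_trivial] at h3
  rw [h3]
  exact Finset.sum_congr rfl fun e _ => by simp; ring

/-- If some `c i ≠ 0`, then `c i * g i ^ 2` is atomless and independent of the other terms, so the
sum is atomless by Fubini. If all coefficients vanish, the sum is `0`, which is why `a ≠ 0` is
required. -/
theorem ae_sum_mul_sq_ne [DecidableEq E] (c : E → ℝ) {a : ℝ} (ha : a ≠ 0) :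
    ∀ᵐ g ∂(gaussianPi E), ∑ e, c e * g e ^ 2 ≠ a := by
  by_cases hc : ∀ e, c e = 0
  · simp [hc, ha.symm]
  push Not at hc
  obtain ⟨i, hi⟩ := hc
  set f : E → (E → ℝ) → ℝ := fun e g => c e * g e ^ 2 with hf
  have hfm : ∀ e, Measurable (f e) := fun e => by simp only [hf]; fun_prop
  have hind : iIndepFun f (gaussianPi E) :=
    iIndepFun_pi (X := fun e (x : ℝ) => c e * x ^ 2) fun e => by fun_prop
  have hXY := hind.indepFun_finsetSum_of_notMem hfm (Finset.notMem_erase i Finset.univ)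
  set X : (E → ℝ) → ℝ := ∑ j ∈ Finset.univ.erase i, f j with hX
  have hXm : Measurable X := by
    simpa only [hX, ← Finset.sum_apply] using Finset.measurable_sum _ fun e _ => hfm e
  have hsum : ∀ g : E → ℝ, ∑ e, c e * g e ^ 2 = X g + f i g := by
    intro g
    rw [hX, Finset.sum_apply, Finset.sum_erase_add _ _ (Finset.mem_univ i)]
  have hmap := (indepFun_iff_map_prod_eq_prod_map_map hXm.aemeasurable (hfm i).aemeasurable).1 hXY
  have hY : ∀ y : ℝ, ((gaussianPi E).map (f i)) {y} = 0 := by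
    intro y
    have h1 : f i = (fun x : ℝ => c i * x ^ 2) ∘ Function.eval i := rfl
    rw [h1, ← Measure.map_map (by fun_prop) (by fun_prop),
      (measurePreserving_eval (fun _ : E => gaussianReal 0 1) i).map_eq,
      Measure.map_apply (by fun_prop) (measurableSet_singleton y)]
    have := nullSingletonClass_gaussianReal (μ := 0) (v := 1) one_ne_zero
    refine Set.Countable.measure_zero (Set.Finite.countable ?_) _
    refine (Set.toFinite {√(y / c i), -√(y / c i)}).subset fun x hx => ?_
    have hx : c i * x ^ 2 = y := hx
    have h2 : y / c i = x ^ 2 := by rw [← hx]; field_simp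
    rw [h2, Real.sqrt_sq_eq_abs]
    rcases abs_choice x with h | h <;> simp [h]
  have hm : MeasurableSet {p : ℝ × ℝ | p.1 + p.2 = a} :=
    measurableSet_eq_fun (by fun_prop) (by fun_prop)
  have hnull : ((gaussianPi E).map fun g => (X g, f i g)) {p : ℝ × ℝ | p.1 + p.2 = a} = 0 := by
    rw [hmap]
    refine (Measure.measure_prod_null hm).2 (.of_forall fun x => ?_)
    have : Prod.mk x ⁻¹' {p : ℝ × ℝ | p.1 + p.2 = a} = {a - x} := by
      ext y
      simp [eq_sub_iff_add_eq, add_comm]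
    simp only [this]
    exact hY _
  rw [Measure.map_apply (hXm.prodMk (hfm i)) hm] at hnull
  rw [ae_iff]
  simpa [hsum] using hnull

/-- Lets `deviationProb_pos` give positive mass to a neighbourhood of the origin. -/
instance isOpenPosMeasure_gaussianReal : (gaussianReal 0 1).IsOpenPosMeasure :=
  (gaussianReal_absolutelyContinuous' 0 one_ne_zero).isOpenPosMeasure

end GaussianQuadraticForm

/-! ### The measurement energy as a Gaussian quadratic form. -/

namespace Network

theorem matA_mulVec {V E : Type*} [DecidableEq V] [Fintype V] (N : Network V E) (α : ℕ → E → V → ℝ) (t : ℕ) (x : V → ℝ) (e : E) :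
    (N.matA α t *ᵥ x) e = α t e (N.tail e) * x (N.tail e) := by
  simp [matA, Matrix.mulVec, dotProduct, ite_mul]

variable {V E : Type*} [DecidableEq V] [Fintype E] [DecidableEq E]

theorem PsiTot_eq_Omega_mul (N : Network V E) (b : ℕ → E → ℝ) (β : ℕ → E → E → ℝ)
    (α : ℕ → E → V → ℝ) (hα : ∀ t, 2 < t → ∀ e, α t e (N.tail e) = 0) (t : ℕ) :
    N.PsiTot b β α t = N.Omega b β t * N.matA α 2 := by
  have hA : ∀ t', 2 < t' → N.matA α t' = 0 := by
    intro t' ht'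
    ext e v
    simp only [matA, Matrix.of_apply, Matrix.zero_apply, ite_eq_right_iff]
    rintro rfl
    exact hα t' ht' e
  ext ⟨⟨τ, hτ⟩, i⟩ v
  have h2 : 2 ∈ Finset.Icc 2 τ := Finset.mem_Icc.2 ⟨le_rfl, (Finset.mem_Icc.1 hτ).1⟩
  have hsum : N.Psi b β α τ = N.matB b τ * N.descProd β 2 (τ - 2) * N.matA α 2 := by
    rw [Psi, Finset.sum_eq_single_of_mem 2 h2, Matrix.mul_assoc]
    intro t' ht' hne
    rw [hA t' (lt_of_le_of_ne (Finset.mem_Icc.1 ht').1 hne.symm), Matrix.mul_zero]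
  simp only [PsiTot, Matrix.of_apply, hsum, Omega, Matrix.mul_apply]

theorem measNormSq_PsiTot [Fintype V] (N : Network V E) (b : ℕ → E → ℝ) (β : ℕ → E → E → ℝ)
    (α : ℕ → E → V → ℝ) (hα : ∀ t, 2 < t → ∀ e, α t e (N.tail e) = 0) (t : ℕ)
    (x : EuclideanSpace ℝ V) :
    measNormSq (N.PsiTot b β α t) x =
      ∑ i, (∑ e, N.Omega b β t i e * (α 2 e (N.tail e) * x (N.tail e))) ^ 2 := by
  rw [measNormSq, EuclideanSpace.real_norm_sq_eq, PsiTot_eq_Omega_mul N b β α hα,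
    ← Matrix.mulVec_mulVec]
  refine Finset.sum_congr rfl fun i _ => ?_
  simp_rw [← matA_mulVec]
  rfl

theorem dotProduct_Gam_mulVec (N : Network V E) (b : ℕ → E → ℝ) (β : ℕ → E → E → ℝ) (σ : E → ℝ≥0)
    (t : ℕ) (x : EuclideanSpace ℝ V) (g : E → ℝ) :
    g ⬝ᵥ N.Gam b β σ t x *ᵥ g =
      ∑ i, (∑ e, N.Omega b β t i e * ((σ e * g e) * x (N.tail e))) ^ 2 := by
  simp only [dotProduct, Matrix.mulVec, Gam, Matrix.of_apply, Finset.mul_sum, Finset.sum_mul,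
    pow_two]
  simp_rw [Finset.sum_comm (s := (Finset.univ : Finset E)) (t := (Finset.univ : Finset (N.Rows t)))]
  exact Finset.sum_congr rfl fun i _ => Finset.sum_congr rfl fun e _ =>
    Finset.sum_congr rfl fun e' _ => by ring

theorem continuous_dotProduct_Gam_mulVec (N : Network V E) (b : ℕ → E → ℝ) (β : ℕ → E → E → ℝ)
    (σ : E → ℝ≥0) (t : ℕ) :
    Continuous fun p : EuclideanSpace ℝ V × (E → ℝ) => p.2 ⬝ᵥ N.Gam b β σ t p.1 *ᵥ p.2 := by
  simp_rw [dotProduct_Gam_mulVec]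
  fun_prop

/-- The squared norm of the measurements of `x` is distributed as the quadratic form of `Γ(x)` in
independent standard Gaussian variables. -/
theorem hasLaw_measNormSq_PsiTot [Fintype V] (N : Network V E) {S : Type*} [MeasurableSpace S]
    {P : Measure S} [IsProbabilityMeasure P] (b : ℕ → E → ℝ) (β : ℕ → E → E → ℝ)
    (α : ℕ → E → V → S → ℝ) (σ : E → ℝ≥0)
    (hα_zero : ∀ t, 2 < t → ∀ e w, α t e (N.tail e) w = 0)
    (hα_gauss : ∀ e, HasLaw (α 2 e (N.tail e)) (gaussianReal 0 (σ e ^ 2)) P)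
    (hα_indep : iIndepFun (fun e => α 2 e (N.tail e)) P) (t : ℕ) (x : EuclideanSpace ℝ V) :
    HasLaw (fun w => measNormSq (N.PsiTot b β (fun t e v => α t e v w) t) x)
      ((gaussianPi E).map fun g => g ⬝ᵥ N.Gam b β σ t x *ᵥ g) P := by
  -- Scaling standard Gaussians also covers `σ e = 0`, where the law is a Dirac mass.
  have hvec : HasLaw (fun w e => α 2 e (N.tail e) w)
      ((gaussianPi E).map fun g e => σ e * g e) P := by
    refine ⟨aemeasurable_pi_lambda _ fun e => (hα_gauss e).aemeasurable, ?_⟩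
    rw [hα_indep.map_fun_eq_pi_map fun e => (hα_gauss e).aemeasurable,
      Measure.pi_map_pi (f := fun e (x : ℝ) => σ e * x) fun e => by fun_prop]
    congr with e : 1
    rw [(hα_gauss e).map_eq, gaussianReal_map_const_mul, mul_zero, mul_one]
    congr 1
  set q : (E → ℝ) → ℝ := fun a =>
    ∑ i, (∑ e, N.Omega b β t i e * (a e * x (N.tail e))) ^ 2 with hq
  have hqm : Measurable q := Continuous.measurable (by fun_prop)
  have h : (fun w => measNormSq (N.PsiTot b β (fun t e v => α t e v w) t) x) =
      q ∘ fun w e => α 2 e (N.tail e) w := by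
    ext w
    rw [measNormSq_PsiTot N b β _ (fun t ht e => hα_zero t ht e w)]
    rfl
  rw [h]
  refine HasLaw.comp ⟨hqm.aemeasurable, ?_⟩ hvec
  rw [Measure.map_map hqm (by fun_prop)]
  congr 1
  ext g
  rw [dotProduct_Gam_mulVec]
  rfl

end Network

/-! ### Nets of the unit sphere by volume packing. -/

section Nets

variable {F : Type*} [NormedAddCommGroup F] [NormedSpace ℝ F] [FiniteDimensional ℝ F]

/-- The balls of radius `1/14` around the points are disjoint and lie in the ball of radius `15/14`;
compare volumes. -/
theorem card_le_of_separated_of_norm_le_one (s : Finset F) (hs : ∀ c ∈ s, ‖c‖ ≤ 1)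
    (h : ∀ c ∈ s, ∀ d ∈ s, c ≠ d → 1 / 7 ≤ ‖c - d‖) :
    s.card ≤ 15 ^ Module.finrank ℝ F := by
  borelize F
  let μ : Measure F := Measure.addHaar
  let δ : ℝ := 1 / 14
  let ρ : ℝ := 15 / 14
  have ρpos : 0 < ρ := by norm_num [ρ]
  have δpos : 0 < δ := by norm_num [δ]
  have D : Set.Pairwise (s : Set F) (Function.onFun Disjoint fun c => Metric.ball c δ) := by
    rintro c hc d hd hcd
    apply Metric.ball_disjoint_ball
    rw [dist_eq_norm]
    refine le_trans ?_ (h c hc d hd hcd)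
    norm_num [δ]
  have hsub : (⋃ c ∈ s, Metric.ball c δ) ⊆ Metric.ball (0 : F) ρ := by
    refine Set.iUnion₂_subset fun x hx => Metric.ball_subset_ball' ?_
    rw [dist_zero_right]
    refine (add_le_add le_rfl (hs x hx)).trans ?_
    norm_num [δ, ρ]
  have I : (s.card : ENNReal) * ENNReal.ofReal (δ ^ Module.finrank ℝ F) * μ (Metric.ball 0 1) ≤
      ENNReal.ofReal (ρ ^ Module.finrank ℝ F) * μ (Metric.ball 0 1) :=
    calc
      _ = μ (⋃ c ∈ s, Metric.ball c δ) := by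
        rw [measure_biUnion_finset D fun c _ => measurableSet_ball]
        simp only [μ.addHaar_ball_of_pos _ δpos]
        simp only [Finset.sum_const, nsmul_eq_mul, mul_assoc]
      _ ≤ μ (Metric.ball (0 : F) ρ) := measure_mono hsub
      _ = _ := by simp only [μ.addHaar_ball_of_pos _ ρpos]
  have J := (ENNReal.mul_le_mul_iff_left (Metric.measure_ball_pos _ _ zero_lt_one).ne'
    measure_ball_lt_top.ne).1 I
  have K : (s.card : ℝ) ≤ (15 : ℝ) ^ Module.finrank ℝ F := by
    have := ENNReal.toReal_le_of_le_ofReal (pow_nonneg ρpos.le _) J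
    rw [ENNReal.toReal_mul, ENNReal.toReal_natCast, ENNReal.toReal_ofReal (by positivity),
      ← le_div_iff₀ (by positivity), ← div_pow] at this
    refine this.trans_eq ?_
    norm_num [δ, ρ]
  exact_mod_cast K

/-- A separated set of largest cardinality is a net, since a point far from all of it could be
added. -/
theorem exists_net_unit_sphere (F : Type*) [NormedAddCommGroup F] [NormedSpace ℝ F]
    [FiniteDimensional ℝ F] :
    ∃ s : Finset F, (∀ q ∈ s, ‖q‖ = 1) ∧ s.card ≤ 15 ^ Module.finrank ℝ F ∧
      ∀ x : F, ‖x‖ = 1 → ∃ q ∈ s, ‖x - q‖ ≤ 1 / 7 := by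
  classical
  let Q : ℕ → Prop := fun m => ∃ s : Finset F, s.card = m ∧ (∀ q ∈ s, ‖q‖ = 1) ∧
    ∀ c ∈ s, ∀ d ∈ s, c ≠ d → 1 / 7 ≤ ‖c - d‖
  have hb : ∀ m, Q m → m ≤ 15 ^ Module.finrank ℝ F := by
    rintro m ⟨s, rfl, h1, h2⟩
    exact card_le_of_separated_of_norm_le_one s (fun c hc => (h1 c hc).le) h2
  have h0 : Q 0 := ⟨∅, by simp⟩
  obtain ⟨s, hcard, hs, hsep⟩ : Q (Nat.findGreatest Q (15 ^ Module.finrank ℝ F)) :=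
    Nat.findGreatest_spec (Nat.zero_le _) h0
  refine ⟨s, hs, hcard ▸ Nat.findGreatest_le _, fun x hx => ?_⟩
  by_contra! hfar
  have hxs : x ∉ s := fun h => by
    have := hfar x h
    rw [sub_self, norm_zero] at this
    norm_num at this
  have hQ : Q (s.card + 1) := by
    refine ⟨insert x s, Finset.card_insert_of_notMem hxs, ?_, ?_⟩
    · intro q hq
      rcases Finset.mem_insert.1 hq with rfl | hq
      exacts [hx, hs q hq]
    · intro c hc d hd hcd
      rcases Finset.mem_insert.1 hc with h | h <;> rcases Finset.mem_insert.1 hd with h' | h'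
      · exact absurd (h.trans h'.symm) hcd
      · rw [h]; exact (hfar d h').le
      · rw [h', norm_sub_rev]; exact (hfar c h).le
      · exact hsep c h d h' hcd
  have := Nat.le_findGreatest (hb _ hQ) hQ
  omega

end Nets

/-! ### From a net to the whole space. -/

section Isometry

/-- Polarisation of `⟪u - v, u + v⟫`, with a weight that balances the two vectors. -/
theorem norm_sq_sub_norm_sq_eq {H : Type*} [NormedAddCommGroup H] [InnerProductSpace ℝ H] (u v : H)
    {c : ℝ} (hc : c ≠ 0) :
    ‖u‖ ^ 2 - ‖v‖ ^ 2 =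
      (‖c • (u - v) + c⁻¹ • (u + v)‖ ^ 2 - ‖c • (u - v) - c⁻¹ • (u + v)‖ ^ 2) / 4 := by
  rw [norm_add_sq_real, norm_sub_sq_real, inner_smul_left, inner_smul_right, inner_sub_left,
    inner_add_right, inner_add_right, real_inner_self_eq_norm_sq, real_inner_self_eq_norm_sq,
    real_inner_comm u v]
  simp only [conj_trivial]
  linear_combination (-(‖u‖ ^ 2 - ‖v‖ ^ 2)) * mul_inv_cancel₀ hc

variable {F G : Type*} [NormedAddCommGroup F] [InnerProductSpace ℝ F] [FiniteDimensional ℝ F]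
  [NormedAddCommGroup G] [InnerProductSpace ℝ G]

/-- A near-isometry estimate on a `1/7`-net of the unit sphere extends to the whole space. -/
theorem abs_norm_sq_sub_le_of_net (L : F →ₗ[ℝ] G) {s : Finset F} (hs : ∀ q ∈ s, ‖q‖ = 1)
    (hnet : ∀ x : F, ‖x‖ = 1 → ∃ q ∈ s, ‖x - q‖ ≤ 1 / 7) {δ : ℝ} (hδ : 0 ≤ δ)
    (hL : ∀ q ∈ s, |‖L q‖ ^ 2 - 1| ≤ δ / √2) (x : F) :
    |‖L x‖ ^ 2 - ‖x‖ ^ 2| ≤ δ * ‖x‖ ^ 2 := by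
  set Q : F → ℝ := fun x => ‖L x‖ ^ 2 - ‖x‖ ^ 2 with hQ
  have hQc : Continuous Q := by
    have := L.continuous_of_finiteDimensional
    fun_prop
  have hQsmul : ∀ (c : ℝ) (x : F), Q (c • x) = c ^ 2 * Q x := by
    intro c x
    simp only [hQ, map_smul, norm_smul, mul_pow, Real.norm_eq_abs, sq_abs]
    ring
  by_cases hx : x = 0
  · simp [hx]
  have hx0 : ‖x‖ ≠ 0 := norm_ne_zero_iff.2 hx
  have hu : ‖(‖x‖⁻¹ • x)‖ = 1 := by
    rw [norm_smul, norm_inv, norm_norm, inv_mul_cancel₀ hx0]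
  have : ProperSpace F := FiniteDimensional.proper ℝ F
  -- The defect `|Q|` is maximal at `y`; comparing `y` with a nearby net point bounds the maximum
  -- `M` in terms of itself.
  obtain ⟨y, hy, hmax⟩ := (isCompact_sphere (0 : F) 1).exists_isMaxOn
    ⟨‖x‖⁻¹ • x, by simpa using hu⟩ hQc.abs.continuousOn
  have hy : ‖y‖ = 1 := by simpa using hy
  set M := |Q y| with hM
  have hM0 : 0 ≤ M := abs_nonneg _
  have hbound : ∀ z : F, |Q z| ≤ M * ‖z‖ ^ 2 := by
    intro z
    by_cases hz : z = 0
    · simp [hz, hQ]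
    have hz0 : ‖z‖ ≠ 0 := norm_ne_zero_iff.2 hz
    have h1 : ‖(‖z‖⁻¹ • z)‖ = 1 := by
      rw [norm_smul, norm_inv, norm_norm, inv_mul_cancel₀ hz0]
    have h2 : |Q (‖z‖⁻¹ • z)| ≤ M := hmax (by simpa using h1)
    rw [hQsmul, abs_mul, abs_of_nonneg (sq_nonneg _), inv_pow, inv_mul_le_iff₀ (by positivity)] at h2
    linarith
  obtain ⟨q, hq, hyq⟩ := hnet y hy
  -- The weight `√14` balances `‖y - q‖ ≤ 1/7` against `‖y + q‖ ≤ 2`: both scaled squares are at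
  -- most `2/7`.
  have hpolar : Q y - Q q = (Q ((√14) • (y - q) + (√14)⁻¹ • (y + q)) -
      Q ((√14) • (y - q) - (√14)⁻¹ • (y + q))) / 4 := by
    have h1 := norm_sq_sub_norm_sq_eq y q (by positivity : √14 ≠ 0)
    have h2 := norm_sq_sub_norm_sq_eq (L y) (L q) (by positivity : √14 ≠ 0)
    simp only [hQ, map_add, map_sub, map_smul]
    linarith
  have hpar : ‖(√14) • (y - q) + (√14)⁻¹ • (y + q)‖ ^ 2 +
      ‖(√14) • (y - q) - (√14)⁻¹ • (y + q)‖ ^ 2 ≤ 8 / 7 := by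
    have h := parallelogram_law_with_norm ℝ ((√14) • (y - q)) ((√14)⁻¹ • (y + q))
    have h1 : ‖(√14) • (y - q)‖ ^ 2 ≤ 2 / 7 := by
      rw [norm_smul, mul_pow, Real.norm_eq_abs, sq_abs, Real.sq_sqrt (by norm_num)]
      nlinarith [norm_nonneg (y - q)]
    have h2 : ‖(√14)⁻¹ • (y + q)‖ ^ 2 ≤ 2 / 7 := by
      rw [norm_smul, mul_pow, Real.norm_eq_abs, sq_abs, inv_pow, Real.sq_sqrt (by norm_num)]
      have h3 : ‖y + q‖ ≤ 2 := (norm_add_le _ _).trans (by rw [hy, hs q hq]; norm_num)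
      nlinarith [norm_nonneg (y + q)]
    linarith
  have hdiff : |Q y - Q q| ≤ 2 / 7 * M := by
    rw [hpolar, abs_div, abs_of_pos (by norm_num : (0 : ℝ) < 4), div_le_iff₀ (by norm_num)]
    refine (abs_sub _ _).trans ((add_le_add (hbound _) (hbound _)).trans ?_)
    rw [← mul_add]
    nlinarith
  have hq1 : |Q q| ≤ δ / √2 := by
    have := hL q hq
    simpa [hQ, hs q hq] using this
  have hM1 : M ≤ δ := by
    have h1 : M ≤ |Q y - Q q| + |Q q| := by simpa using abs_add_le (Q y - Q q) (Q q)
    -- Absorbing `2/7 * M` leaves `5/7 * M ≤ δ/√2`, and `7/5 ≤ √2`.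
    have h2 : δ / √2 ≤ 5 / 7 * δ := by
      rw [div_le_iff₀ (by positivity)]
      have : (7 / 5 : ℝ) ≤ √2 := Real.le_sqrt_of_sq_le (by norm_num)
      nlinarith
    linarith
  exact (hbound x).trans (by gcongr)

end Isometry

/-! ### Reduction of the restricted isometry property to finitely many vectors. -/

section RestrictedIsometry

variable {V : Type*} [DecidableEq V]

theorem measNormSq_eq_norm_toEuclideanLin {ι V : Type*} [Fintype ι] [Fintype V] [DecidableEq V]
    (Θ : Matrix ι V ℝ) (s : EuclideanSpace ℝ V) :
    measNormSq Θ s = ‖Matrix.toEuclideanLin Θ s‖ ^ 2 := rfl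

/-- The extension by zero of vectors indexed by `T`. -/
def extendZero (T : Finset V) : EuclideanSpace ℝ T →ₗ[ℝ] EuclideanSpace ℝ V where
  toFun s := WithLp.toLp 2 fun v => if h : v ∈ T then s ⟨v, h⟩ else 0
  map_add' s s' := by
    ext v
    by_cases h : v ∈ T <;> simp [h]
  map_smul' c s := by
    ext v
    by_cases h : v ∈ T <;> simp [h]

theorem norm_extendZero [Fintype V] (T : Finset V) (s : EuclideanSpace ℝ T) : ‖extendZero T s‖ = ‖s‖ := by
  rw [EuclideanSpace.norm_eq, EuclideanSpace.norm_eq]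
  congr 1
  rw [← Finset.sum_subset (Finset.subset_univ T), ← Finset.sum_attach T]
  · refine Finset.sum_congr rfl fun v _ => ?_
    simp [extendZero]
  · intro v _ hv
    simp [extendZero, hv]

theorem exists_extendZero_eq {T : Finset V} {s : EuclideanSpace ℝ V} (hs : ∀ v, s v ≠ 0 → v ∈ T) :
    ∃ s', extendZero T s' = s := by
  refine ⟨WithLp.toLp 2 fun v => s v, ?_⟩
  ext v
  by_cases h : v ∈ T
  · simp [extendZero, h]
  · simp [extendZero, h, not_imp_comm.1 (hs v) h]

/-- The restricted isometry property of order `k` can be tested on at most `(n choose k) 15 ^ k`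
unit vectors. -/
theorem exists_finset_forall_isRIP (V : Type*) [Fintype V] [DecidableEq V] {k : ℕ}
    (hk : k ≤ Fintype.card V) :
    ∃ s : Finset (EuclideanSpace ℝ V), (∀ q ∈ s, ‖q‖ = 1) ∧
      s.card ≤ (Fintype.card V).choose k * 15 ^ k ∧
      (k = 0 → s = ∅) ∧
      ∀ {ι : Type*} [Fintype ι] (Θ : Matrix ι V ℝ) {δ : ℝ}, 0 ≤ δ →
        (∀ q ∈ s, |measNormSq Θ q - 1| ≤ δ / √2) → IsRIP k δ Θ := by
  classical
  choose net hnet1 hnetcard hnet using fun T : Finset V =>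
    exists_net_unit_sphere (EuclideanSpace ℝ T)
  refine ⟨(Finset.powersetCard k Finset.univ).biUnion fun T => (net T).image (extendZero T),
    ?_, ?_, ?_, ?_⟩
  · intro q hq
    simp only [Finset.mem_biUnion, Finset.mem_image] at hq
    obtain ⟨T, -, q', hq', rfl⟩ := hq
    rw [norm_extendZero, hnet1 T q' hq']
  · refine Finset.card_biUnion_le.trans ((Finset.sum_le_card_nsmul _ _ (15 ^ k) ?_).trans ?_)
    · intro T hT
      have h := hnetcard T
      rw [finrank_euclideanSpace, Fintype.card_coe, (Finset.mem_powersetCard.1 hT).2] at h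
      exact Finset.card_image_le.trans h
    · rw [Finset.card_powersetCard, Finset.card_univ, smul_eq_mul]
  -- The zero space has no unit vector. This case matters for strictness: at `k = 0` the factors `15
  -- ^ k` and `(42/δ) ^ k` coincide.
  · rintro rfl
    rw [Finset.powersetCard_zero, Finset.singleton_biUnion, Finset.image_eq_empty,
      Finset.eq_empty_iff_forall_notMem]
    intro q hq
    have := hnet1 ∅ q hq
    rw [Subsingleton.elim q 0, norm_zero] at this
    exact zero_ne_one this
  · intro ι _ Θ δ hδ hΘ s hsk
    have hsk' : (Finset.univ.filter fun v => s v ≠ 0).card ≤ k := by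
      rwa [Set.ncard_eq_toFinset_card', Set.toFinset_ofPred] at hsk
    -- Supports are enlarged to exactly `k` elements, so only `n choose k` subspaces are needed.
    obtain ⟨T, hT, hTk⟩ := Finset.exists_superset_card_eq hsk' hk
    obtain ⟨s', rfl⟩ := exists_extendZero_eq (T := T) (s := s) fun v hv =>
      hT (Finset.mem_filter.2 ⟨Finset.mem_univ v, hv⟩)
    have h := abs_norm_sq_sub_le_of_net (Matrix.toEuclideanLin Θ ∘ₗ extendZero T) (hnet1 T)
      (hnet T) hδ (fun q hq => by
        rw [LinearMap.comp_apply, ← measNormSq_eq_norm_toEuclideanLin]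
        exact hΘ _ (Finset.mem_biUnion.2 ⟨T, Finset.mem_powersetCard.2
          ⟨Finset.subset_univ T, hTk⟩, Finset.mem_image_of_mem _ hq⟩)) s'
    rw [LinearMap.comp_apply, ← measNormSq_eq_norm_toEuclideanLin, ← norm_extendZero, abs_le] at h
    constructor <;> linarith

end RestrictedIsometry

theorem measNormSq_mul {ι V : Type*} [Fintype ι] [Fintype V] (Θ : Matrix ι V ℝ) (φ : Matrix V V ℝ)
    (s : EuclideanSpace ℝ V) :
    measNormSq (Θ * φ) s = measNormSq Θ (WithLp.toLp 2 (φ *ᵥ s.ofLp)) := by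
  rw [measNormSq, measNormSq, Matrix.mulVec_mulVec]

theorem norm_toLp_mulVec_of_mem_orthogonalGroup {V : Type*} [Fintype V] [DecidableEq V]
    {φ : Matrix V V ℝ} (hφ : φ ∈ Matrix.orthogonalGroup V ℝ) (s : EuclideanSpace ℝ V) :
    ‖(WithLp.toLp 2 (φ *ᵥ s.ofLp) : EuclideanSpace ℝ V)‖ = ‖s‖ := by
  have h : ∀ y : V → ℝ, ‖(WithLp.toLp 2 y : EuclideanSpace ℝ V)‖ ^ 2 = y ⬝ᵥ y := fun y => by
    rw [EuclideanSpace.real_norm_sq_eq]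
    exact Finset.sum_congr rfl fun v _ => pow_two _
  have hsq : ‖(WithLp.toLp 2 (φ *ᵥ s.ofLp) : EuclideanSpace ℝ V)‖ ^ 2 = ‖s‖ ^ 2 := by
    rw [h, Matrix.dotProduct_mulVec, ← Matrix.mulVec_transpose, Matrix.mulVec_mulVec]
    have h1 : φᵀ * φ = 1 := (Matrix.mem_orthogonalGroup_iff' V ℝ).1 hφ
    rw [h1, Matrix.one_mulVec, ← h]
  exact (sq_eq_sq₀ (norm_nonneg _) (norm_nonneg _)).1 hsq

/-! ### The deviation probability and its integral formula. -/

namespace Network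

section

variable {V E : Type*} [DecidableEq V] [Fintype E] [DecidableEq E]

/-- The probability that the quadratic form of `Γ(x)` in independent standard Gaussian variables
deviates from `1` by at least `ε`. -/
def deviationProb (N : Network V E) (b : ℕ → E → ℝ) (β : ℕ → E → E → ℝ) (σ : E → ℝ≥0)
    (t : ℕ) (ε : ℝ) (x : EuclideanSpace ℝ V) : ℝ :=
  (gaussianPi E).real {g | ε ≤ |g ⬝ᵥ N.Gam b β σ t x *ᵥ g - 1|}

variable (N : Network V E) (b : ℕ → E → ℝ) (β : ℕ → E → E → ℝ) (σ : E → ℝ≥0) (t : ℕ) {ε : ℝ}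

theorem measurable_dotProduct_Gam_mulVec (x : EuclideanSpace ℝ V) :
    Measurable fun g : E → ℝ => g ⬝ᵥ N.Gam b β σ t x *ᵥ g :=
  ((N.continuous_dotProduct_Gam_mulVec b β σ t).comp
    (Continuous.prodMk_right x)).measurable

/-- Both `1 + ε` and `1 - ε` are nonzero, so neither can be an atom. Needed for the inversion
formula and for continuity in `x`. -/
theorem ae_abs_dotProduct_Gam_mulVec_sub_ne (hε0 : 0 < ε) (hε1 : ε < 1)
    (x : EuclideanSpace ℝ V) :
    ∀ᵐ g ∂(gaussianPi E), |g ⬝ᵥ N.Gam b β σ t x *ᵥ g - 1| ≠ ε := by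
  have key : ∀ a : ℝ, a ≠ 0 → ∀ᵐ g ∂(gaussianPi E), g ⬝ᵥ N.Gam b β σ t x *ᵥ g ≠ a := by
    intro a ha
    have hm := N.measurable_dotProduct_Gam_mulVec b β σ t x
    have hs : MeasurableSet {z : ℝ | z ≠ a} := (measurableSet_singleton a).compl
    have h := ae_sum_mul_sq_ne (N.gam_isHermitian b β σ t x).eigenvalues ha
    rw [← ae_map_iff hm.aemeasurable hs,
      (N.gam_isHermitian b β σ t x).map_quadraticForm_gaussianPi,
      ae_map_iff (Measurable.aemeasurable (by fun_prop)) hs]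
    exact h
  filter_upwards [key (1 + ε) (by linarith), key (1 - ε) (by linarith)] with g h1 h2 h
  rcases (abs_eq hε0.le).1 h with h | h
  · exact h1 (by linarith)
  · exact h2 (by linarith)

theorem truncIntegral_eq (x : EuclideanSpace ℝ V) (R : ℝ) :
    N.truncIntegral b β σ t ε x R = ∫ ω in (-R)..R, Complex.exp (-(Complex.I * ((1 : ℝ) * ω))) *
      ((ε * Real.sinc (ε * ω) : ℝ) : ℂ) *
      charFun ((gaussianPi E).map fun g => g ⬝ᵥ N.Gam b β σ t x *ᵥ g) ω := by
  -- At `ω = 0` the original integrand is `0` by the convention for division, unlike the `sinc`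
  -- form; one point is negligible.
  have hne : ∀ᵐ ω : ℝ, ω ≠ 0 := compl_mem_ae_iff.2 (measure_singleton 0)
  refine intervalIntegral.integral_congr_ae (hne.mono fun ω hω _ => ?_)
  have hsinc : ε * Real.sinc (ε * ω) = Real.sin (ε * ω) / ω := by
    by_cases hε : ε = 0
    · simp [hε]
    · rw [Real.sinc_of_ne_zero (mul_ne_zero hε hω)]
      field_simp
  rw [(N.gam_isHermitian b β σ t x).map_quadraticForm_gaussianPi, charFun_map_sum_mul_sq, hsinc,
    integrand, Complex.ofReal_one, one_mul, Complex.ofReal_div]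
  simp only [eigen]
  rw [div_mul_eq_div_div, div_eq_mul_inv _ (∏ e, _), mul_div_assoc]

theorem deviationProb_eq (x : EuclideanSpace ℝ V) :
    N.deviationProb b β σ t ε x = 1 -
      ((gaussianPi E).map fun g => g ⬝ᵥ N.Gam b β σ t x *ᵥ g).real {z | |z - 1| < ε} := by
  have hm := N.measurable_dotProduct_Gam_mulVec b β σ t x
  have hs : MeasurableSet {z : ℝ | |z - 1| < ε} := measurableSet_lt (by fun_prop) measurable_const
  rw [map_measureReal_apply hm hs, ← probReal_compl_eq_one_sub (hm hs), deviationProb]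
  congr 1
  ext g
  simp

theorem tendsto_truncIntegral (hε0 : 0 < ε) (hε1 : ε < 1) (x : EuclideanSpace ℝ V) :
    Tendsto (N.truncIntegral b β σ t ε x) atTop
      (𝓝 ((Real.pi * (1 - N.deviationProb b β σ t ε x) : ℝ) : ℂ)) := by
  have hm := N.measurable_dotProduct_Gam_mulVec b β σ t x
  have : IsProbabilityMeasure ((gaussianPi E).map fun g => g ⬝ᵥ N.Gam b β σ t x *ᵥ g) :=
    Measure.isProbabilityMeasure_map hm.aemeasurable
  rw [deviationProb_eq, sub_sub_cancel]
  simp_rw [funext (N.truncIntegral_eq b β σ t x)]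
  refine tendsto_integral_charFun_mul_sinc _ 1 hε0 ?_
  have hs : MeasurableSet {z : ℝ | |z - 1| ≠ ε} :=
    (measurableSet_singleton ε).compl.preimage (f := fun z : ℝ => |z - 1|) (by fun_prop)
  rw [ae_map_iff hm.aemeasurable hs]
  exact N.ae_abs_dotProduct_Gam_mulVec_sub_ne b β σ t hε0 hε1 x

theorem tailIntegral_eq (hε0 : 0 < ε) (hε1 : ε < 1) (x : EuclideanSpace ℝ V) :
    N.tailIntegral b β σ t ε x = Real.pi * (1 - N.deviationProb b β σ t ε x) := by
  rw [tailIntegral, (N.tendsto_truncIntegral b β σ t hε0 hε1 x).limUnder_eq, Complex.ofReal_re]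

/-- For almost every fixed `g` the deviation at `x` is not exactly `ε`, so the indicator is locally
constant in the vector near `x`; dominated convergence applies. -/
theorem continuous_deviationProb [Fintype V] (hε0 : 0 < ε) (hε1 : ε < 1) :
    Continuous (N.deviationProb b β σ t ε) := by
  have hcont := N.continuous_dotProduct_Gam_mulVec b β σ t
  have hset : ∀ x, MeasurableSet {g : E → ℝ | ε ≤ |g ⬝ᵥ N.Gam b β σ t x *ᵥ g - 1|} := fun x =>
    measurableSet_le measurable_const
      ((N.measurable_dotProduct_Gam_mulVec b β σ t x).sub_const 1).abs
  have heq : N.deviationProb b β σ t ε = fun x => ∫ g, Set.indicator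
      {g : E → ℝ | ε ≤ |g ⬝ᵥ N.Gam b β σ t x *ᵥ g - 1|} (fun _ => (1 : ℝ)) g ∂(gaussianPi E) := by
    ext x
    rw [integral_indicator_const _ (hset x), smul_eq_mul, mul_one, deviationProb]
  rw [heq, continuous_iff_continuousAt]
  intro x
  refine tendsto_integral_filter_of_dominated_convergence (fun _ => 1)
    (.of_forall fun y => (measurable_const.indicator (hset y)).aestronglyMeasurable)
    (.of_forall fun y => .of_forall fun g => ?_) (integrable_const _) ?_
  · exact (norm_indicator_le_norm_self _ _).trans (by simp)
  · filter_upwards [N.ae_abs_dotProduct_Gam_mulVec_sub_ne b β σ t hε0 hε1 x] with g hg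
    have hc : Continuous fun y => |g ⬝ᵥ N.Gam b β σ t y *ᵥ g - 1| :=
      ((hcont.comp (Continuous.prodMk_left g)).sub continuous_const).abs
    refine tendsto_const_nhds.congr' ?_
    rcases lt_or_gt_of_ne hg with h | h
    · filter_upwards [hc.continuousAt.eventually_lt_const h] with y hy
      rw [Set.indicator_of_notMem (by simpa using h), Set.indicator_of_notMem (by simpa using hy)]
    · filter_upwards [hc.continuousAt.eventually_const_lt h] with y hy
      rw [Set.indicator_of_mem (by simpa using h.le), Set.indicator_of_mem (by simpa using hy.le)]

/-- Near `g = 0` the form is below `1 - ε`, and such `g` fill a nonempty open set. This holds even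
for degenerate `Γ(x)`. -/
theorem deviationProb_pos (hε1 : ε < 1) (x : EuclideanSpace ℝ V) :
    0 < N.deviationProb b β σ t ε x := by
  have hc : Continuous fun g : E → ℝ => g ⬝ᵥ N.Gam b β σ t x *ᵥ g :=
    (N.continuous_dotProduct_Gam_mulVec b β σ t).comp (Continuous.prodMk_right x)
  have hopen : IsOpen {g : E → ℝ | g ⬝ᵥ N.Gam b β σ t x *ᵥ g < 1 - ε} :=
    isOpen_lt hc continuous_const
  have hpos := hopen.measure_pos (gaussianPi E) ⟨0, by simpa using hε1⟩
  rw [deviationProb, measureReal_def, ENNReal.toReal_pos_iff]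
  refine ⟨hpos.trans_le (measure_mono fun g hg => ?_), measure_lt_top _ _⟩
  have hg : g ⬝ᵥ N.Gam b β σ t x *ᵥ g < 1 - ε := hg
  have hle : ε ≤ |g ⬝ᵥ N.Gam b β σ t x *ᵥ g - 1| := le_abs.2 (Or.inr (by linarith))
  exact hle

theorem isLeast_tailIntegral [Fintype V] (hε0 : 0 < ε) (hε1 : ε < 1) :
    IsLeast (N.tailIntegral b β σ t ε '' {x | ‖x‖ = 1}) (N.minTailIntegral b β σ t ε) := by
  have hcont : Continuous (N.tailIntegral b β σ t ε) := by
    have := N.continuous_deviationProb b β σ t hε0 hε1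
    rw [funext (N.tailIntegral_eq b β σ t hε0 hε1)]
    fun_prop
  have hsphere : {x : EuclideanSpace ℝ V | ‖x‖ = 1} = Metric.sphere 0 1 := by
    ext x; simp
  -- The gateway guarantees that `V` is nonempty.
  have hne : {x : EuclideanSpace ℝ V | ‖x‖ = 1}.Nonempty :=
    ⟨EuclideanSpace.single N.gateway 1, by simp⟩
  have hcompact : IsCompact {x : EuclideanSpace ℝ V | ‖x‖ = 1} := by
    rw [hsphere]; exact isCompact_sphere 0 1
  exact (hcompact.image hcont).isLeast_sInf (hne.image _)

theorem deviationProb_le [Fintype V] (hε0 : 0 < ε) (hε1 : ε < 1) {x : EuclideanSpace ℝ V}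
    (hx : ‖x‖ = 1) :
    N.deviationProb b β σ t ε x ≤ 1 - 1 / Real.pi * N.minTailIntegral b β σ t ε := by
  have h := (N.isLeast_tailIntegral b β σ t hε0 hε1).2 ⟨x, hx, rfl⟩
  rw [N.tailIntegral_eq b β σ t hε0 hε1, ← div_le_iff₀' Real.pi_pos] at h
  rw [one_div, inv_mul_eq_div]
  linarith

end

/-! ### The union bound. -/

section Probability

variable {V E : Type*} [Fintype V] [DecidableEq V] [Fintype E] [DecidableEq E]

theorem measureReal_deviation_eq (N : Network V E) {S : Type*} [MeasurableSpace S]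
    {P : Measure S} [IsProbabilityMeasure P] (b : ℕ → E → ℝ) (β : ℕ → E → E → ℝ)
    (α : ℕ → E → V → S → ℝ) (σ : E → ℝ≥0)
    (hα_zero : ∀ t, 2 < t → ∀ e w, α t e (N.tail e) w = 0)
    (hα_gauss : ∀ e, HasLaw (α 2 e (N.tail e)) (gaussianReal 0 (σ e ^ 2)) P)
    (hα_indep : iIndepFun (fun e => α 2 e (N.tail e)) P) (t : ℕ) {ε : ℝ}
    (x : EuclideanSpace ℝ V) :
    P.real {w | ε ≤ |measNormSq (N.PsiTot b β (fun t e v => α t e v w) t) x - 1|} =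
      N.deviationProb b β σ t ε x := by
  have hm := N.measurable_dotProduct_Gam_mulVec b β σ t x
  have hs : MeasurableSet {z : ℝ | ε ≤ |z - 1|} := measurableSet_le measurable_const (by fun_prop)
  rw [measureReal_def, (N.hasLaw_measNormSq_PsiTot b β α σ hα_zero hα_gauss hα_indep t x).measure_eq
    (p := fun z => ε ≤ |z - 1|) hs, Measure.map_apply hm hs]
  rfl

theorem pRIP_lt_measureReal_isRIP (N : Network V E) {S : Type*} [MeasurableSpace S]
    {P : Measure S} [IsProbabilityMeasure P] (b : ℕ → E → ℝ) (β : ℕ → E → E → ℝ)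
    (α : ℕ → E → V → S → ℝ) (σ : E → ℝ≥0)
    (hα_zero : ∀ t, 2 < t → ∀ e w, α t e (N.tail e) w = 0)
    (hα_gauss : ∀ e, HasLaw (α 2 e (N.tail e)) (gaussianReal 0 (σ e ^ 2)) P)
    (hα_indep : iIndepFun (fun e => α 2 e (N.tail e)) P) (t : ℕ) {k : ℕ}
    (hk : k ≤ Fintype.card V) {δ : ℝ} (hδ0 : 0 < δ)
    (hδ1 : δ < 1) {φ : Matrix V V ℝ} (hφ : φ ∈ Matrix.orthogonalGroup V ℝ) :
    N.pRIP b β σ t k δ <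
      P.real {w | IsRIP k δ (N.PsiTot b β (fun t e v => α t e v w) t * φ)} := by
  have hε0 : 0 < δ / √2 := by positivity
  have hε1 : δ / √2 < 1 := by
    rw [div_lt_one (by positivity)]
    exact hδ1.trans (Real.lt_sqrt_of_sq_lt (by norm_num))
  set p := 1 - 1 / Real.pi * N.minTailIntegral b β σ t (δ / √2) with hp
  have hp0 : 0 < p := (N.deviationProb_pos b β σ t hε1 (EuclideanSpace.single N.gateway 1)).trans_le
    (N.deviationProb_le b β σ t hε0 hε1 (by simp))
  obtain ⟨s, hs1, hscard, hs0, hRIP⟩ := exists_finset_forall_isRIP V hk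
  set good : Set S := {w | IsRIP k δ (N.PsiTot b β (fun t e v => α t e v w) t * φ)} with hgood
  set bad : EuclideanSpace ℝ V → Set S := fun q => {w | δ / √2 ≤
    |measNormSq (N.PsiTot b β (fun t e v => α t e v w) t * φ) q - 1|} with hbad
  have hbadp : ∀ q ∈ s, P.real (bad q) ≤ p := by
    intro q hq
    simp only [hbad, measNormSq_mul]
    rw [N.measureReal_deviation_eq b β α σ hα_zero hα_gauss hα_indep]
    exact N.deviationProb_le b β σ t hε0 hε1
      ((norm_toLp_mulVec_of_mem_orthogonalGroup hφ q).trans (hs1 q hq))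
  have hunion : P.real (⋃ q ∈ s, bad q) ≤ s.card * p :=
    (measureReal_biUnion_finset_le _ _).trans
      ((Finset.sum_le_card_nsmul _ _ _ hbadp).trans_eq (nsmul_eq_mul _ _))
  -- Covering the whole space uses only subadditivity, so measurability of `good` is not needed.
  have hcover : 1 ≤ P.real good + P.real (⋃ q ∈ s, bad q) := by
    have hsub : (Set.univ : Set S) ⊆ good ∪ ⋃ q ∈ s, bad q := by
      intro w _
      by_cases h : ∃ q ∈ s, w ∈ bad q
      · exact Or.inr (by simpa using h)
      · push Not at h
        exact Or.inl (hRIP _ hδ0.le fun q hq => (not_le.1 (h q hq)).le)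
    have h1 := (measureReal_mono (μ := P) hsub).trans (measureReal_union_le _ _)
    rwa [probReal_univ] at h1
  have hlt : (s.card : ℝ) * p < (Fintype.card V).choose k * (42 / δ) ^ k * p := by
    refine mul_lt_mul_of_pos_right ?_ hp0
    have hchoose : (0 : ℝ) < (Fintype.card V).choose k := by exact_mod_cast Nat.choose_pos hk
    -- For `k = 0` strictness comes from the empty net; otherwise from `15 * δ < 42`.
    rcases Nat.eq_zero_or_pos k with rfl | hk0
    · rw [hs0 rfl]
      simp
    · have h1 : (s.card : ℝ) ≤ (Fintype.card V).choose k * 15 ^ k := by exact_mod_cast hscard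
      refine h1.trans_lt (mul_lt_mul_of_pos_left ?_ hchoose)
      refine pow_lt_pow_left₀ ?_ (by norm_num) hk0.ne'
      rw [lt_div_iff₀ hδ0]
      linarith
  rw [pRIP, ← hp]
  linarith

end Probability

end Network

end

theorem theorem3 {V E : Type*} [Fintype V] [DecidableEq V] [Fintype E] [DecidableEq E]
    (N : Network V E)
    {S : Type*} [MeasurableSpace S] (P : Measure S) [IsProbabilityMeasure P]
    (b : ℕ → E → ℝ) (β : ℕ → E → E → ℝ) (α : ℕ → E → V → S → ℝ) (σ : E → ℝ≥0)
    (hα_zero : ∀ t, 2 < t → ∀ e w, α t e (N.tail e) w = 0)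
    (hα_gauss : ∀ e, HasLaw (α 2 e (N.tail e)) (gaussianReal 0 (σ e ^ 2)) P)
    (hα_indep : iIndepFun (fun e => α 2 e (N.tail e)) P)
    (t k : ℕ) (hk : k ≤ Fintype.card V) (δ : ℝ) (hδ0 : 0 < δ) (hδ1 : δ < 1) :
    (∀ x : EuclideanSpace ℝ V, ‖x‖ = 1 →
      Tendsto (N.truncIntegral b β σ t (δ / √2) x) atTop
        (𝓝 (N.tailIntegral b β σ t (δ / √2) x : ℂ)) ∧
      P.real {w | δ / √2 ≤
          |measNormSq (N.PsiTot b β (fun t e v => α t e v w) t) x - 1|} =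
        1 - 1 / Real.pi * N.tailIntegral b β σ t (δ / √2) x) ∧
    IsLeast (N.tailIntegral b β σ t (δ / √2) '' {x | ‖x‖ = 1})
      (N.minTailIntegral b β σ t (δ / √2)) ∧
    ∀ φ ∈ Matrix.orthogonalGroup V ℝ,
      N.pRIP b β σ t k δ <
        P.real {w | IsRIP k δ (N.PsiTot b β (fun t e v => α t e v w) t * φ)} := by
  have hε0 : 0 < δ / √2 := by positivity
  have hε1 : δ / √2 < 1 := by
    rw [div_lt_one (by positivity)]
    exact hδ1.trans (Real.lt_sqrt_of_sq_lt (by norm_num))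
  refine ⟨fun x _ => ⟨?_, ?_⟩, N.isLeast_tailIntegral b β σ t hε0 hε1, fun φ hφ =>
    N.pRIP_lt_measureReal_isRIP b β α σ hα_zero hα_gauss hα_indep t hk hδ0 hδ1 hφ⟩
  · rw [N.tailIntegral_eq b β σ t hε0 hε1]
    exact N.tendsto_truncIntegral b β σ t hε0 hε1 x
  · rw [N.measureReal_deviation_eq b β α σ hα_zero hα_gauss hα_indep,
      N.tailIntegral_eq b β σ t hε0 hε1]
    field_simp
    ring
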